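/- Let $\Phi$ be the standard normal distribution function and let $(\alpha_k)_{k\ge 1}$ be real numbers with $|\alpha_k|<1$ for all $k$. For $k\ge1$ let $C_k$ be the Gaussian pair copula with parameter $\alpha_k$, that is, $C_k(u,v)=\Phi_2(\Phi^{-1}(u),\Phi^{-1}(v);\alpha_k)$ for $u,v\in(0,1)$, where $\Phi_2(\cdot,\cdot;r)$ is the distribution function of the centred bivariate normal law with unit variances and correlation $r$. Put $h^{(i)}_k(u_1,u_2)=\partial C_k(u_1,u_2)/\partial u_i$, and define for $k\ge1$, $\boldsymbol u=(u_1,\dots,u_k)\in(0,1)^k$ and $x\in(0,1)$ $$R_k(\boldsymbol u,x)=h^{(1)}_k\big(R^{(2)}_{k-1}(\boldsymbol u_{-1},u_1),R_{k-1}(\boldsymbol u_{-1},x)\big),\qquad R^{(2)}_k(\boldsymbol u,x)=h^{(2)}_k\big(R^{(2)}_{k-1}(\boldsymbol u_{-k},x),R_{k-1}(\boldsymbol u_{-k},u_k)\big),$$ where $\boldsymbol u_{-i}$ is $\boldsymbol u$ with its $i$th component removed and $R_0(\cdot,x)=R^{(2)}_0(\cdot,x)=x$. The $R_k$ are the forward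 Rosenblatt functions. Let $R_k^{-1}(\boldsymbol u,\cdot)$ be the inverse of $R_k(\boldsymbol u,\cdot)$ on $(0,1)$; the inverse Rosenblatt functions are given by $S_1(z_1,x)=R_1^{-1}(z_1,x)$ and, for $k\ge2$, $$S_k(\boldsymbol z,x)=R_k^{-1}\big((z_1,S_1(z_1,z_2),\dots,S_{k-1}((z_1,\dots,z_{k-1}),z_k)),x\big).$$ Then for all $k\ge1$ and all $\boldsymbol u,\boldsymbol z\in(0,1)^k$, the map $R_k(\boldsymbol u,\cdot)$ is a bijection of $(0,1)$ onto itself, and for all $x\in(0,1)$ $$R_k(\boldsymbol u,x)=\Phi\left(\frac{\Phi^{-1}(x)-\sum_{j=1}^k\phi^{(k)}_j\,\Phi^{-1}(u_{k+1-j})}{\sigma_k}\right),\qquad S_k(\boldsymbol z,x)=\Phi\left(\sigma_k\Phi^{-1}(x)+\sum_{j=1}^k\psi^{(k)}_j\,\Phi^{-1}(z_{k+1-j})\right).$$ Here $\sigma_k>0$ with $\sigma_k^2=\prod_{j=1}^k(1-\alpha_j^2)$; the coefficients $\phi^{(k)}_j$ are given by the Durbin–Levinson recursion $\phi^{(k)}_k=\alpha_k$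 and $\phi^{(k)}_j=\phi^{(k-1)}_j-\alpha_k\phi^{(k-1)}_{k-j}$ for $1\le j\le k-1$; and the coefficients $\psi^{(k)}_j$ are given by $\psi^{(0)}_0=1$, $\psi^{(k)}_0=\sigma_k$ for $k\ge1$, and $\psi^{(k)}_j=\sum_{i=1}^j\phi^{(k)}_i\,\psi^{(k-i)}_{j-i}$ for $1\le j\le k$. -/

import Mathlib

namespace SVine

noncomputable section

/-- The standard normal distribution function `Φ`. -/
def stdNormalCDF (x : ℝ) : ℝ :=
  ProbabilityTheory.cdf (ProbabilityTheory.gaussianReal 0 1) x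

/-- `Φ⁻¹`, the inverse of the injective function `Φ`; it is only used at points of `(0,1)`,
the range of `Φ`. -/
def stdNormalQuantile (p : ℝ) : ℝ := Function.invFun stdNormalCDF p

/-- Density of the centred bivariate normal law with unit variances and correlation `r`
(for `|r| < 1`). -/
def bivariateNormalDensity (r s t : ℝ) : ℝ :=
  1 / (2 * Real.pi * √(1 - r ^ 2)) *
    Real.exp (-(s ^ 2 - 2 * r * s * t + t ^ 2) / (2 * (1 - r ^ 2)))

/-- Joint distribution function of the centred bivariate normal law with unit variances and
correlation `r`. -/
def bivariateNormalCDF (r a b : ℝ) : ℝ :=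
  ∫ s in Set.Iic a, ∫ t in Set.Iic b, bivariateNormalDensity r s t

/-- The Gaussian pair copula with parameter `r`, on the open square `(0,1)²`. -/
def gaussianCopula (r u v : ℝ) : ℝ :=
  bivariateNormalCDF r (stdNormalQuantile u) (stdNormalQuantile v)

/-- `h⁽¹⁾(u, v)`: partial derivative of `C` in its first argument. -/
def hOne (C : ℝ → ℝ → ℝ) (u v : ℝ) : ℝ := deriv (fun s => C s v) u

/-- `h⁽²⁾(u, v)`: partial derivative of `C` in its second argument. -/
def hTwo (C : ℝ → ℝ → ℝ) (u v : ℝ) : ℝ := deriv (fun t => C u t) v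

/-- The pair `(R⁽¹⁾ₖ, R⁽²⁾ₖ)` of forward and backward Rosenblatt functions of a sequence of pair
copulas `C 1, C 2, …` (the value `C 0` is never used), by the interlacing recursion
`R⁽¹⁾ₖ(u, x) = h⁽¹⁾ₖ(R⁽²⁾ₖ₋₁(u₋₁, u₁), R⁽¹⁾ₖ₋₁(u₋₁, x))`,
`R⁽²⁾ₖ(u, x) = h⁽²⁾ₖ(R⁽²⁾ₖ₋₁(u₋ₖ, x), R⁽¹⁾ₖ₋₁(u₋ₖ, uₖ))`,
with `R⁽¹⁾₀(·, x) = R⁽²⁾₀(·, x) = x`. Here `u₋₁` is `Fin.tail u` and `u₋ₖ` is `Fin.init u`. -/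
def rosenblattPair (C : ℕ → ℝ → ℝ → ℝ) :
    (k : ℕ) → ((Fin k → ℝ) → ℝ → ℝ) × ((Fin k → ℝ) → ℝ → ℝ)
  | 0 => (fun _ x => x, fun _ x => x)
  | k + 1 =>
    (fun u x =>
      hOne (C (k + 1)) ((rosenblattPair C k).2 (Fin.tail u) (u 0))
        ((rosenblattPair C k).1 (Fin.tail u) x),
     fun u x =>
      hTwo (C (k + 1)) ((rosenblattPair C k).2 (Fin.init u) x)
        ((rosenblattPair C k).1 (Fin.init u) (u (Fin.last k))))

/-- The forward Rosenblatt function `Rₖ = R⁽¹⁾ₖ`. -/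
def forwardRosenblatt (C : ℕ → ℝ → ℝ → ℝ) (k : ℕ) (u : Fin k → ℝ) (x : ℝ) : ℝ :=
  (rosenblattPair C k).1 u x

/-- `Rₖ⁻¹(u, z)`: the inverse, at `z`, of `x ↦ Rₖ(u, x)` as a map of `(0,1)` to itself. -/
def forwardRosenblattInv (C : ℕ → ℝ → ℝ → ℝ) (k : ℕ) (u : Fin k → ℝ) (z : ℝ) : ℝ :=
  Function.invFunOn (forwardRosenblatt C k u) (Set.Ioo 0 1) z

/-- The inverse Rosenblatt functions
`Sₖ(z, x) = Rₖ⁻¹((z₁, S₁(z₁, z₂), …, Sₖ₋₁((z₁, …, zₖ₋₁), zₖ)), x)` for `k ≥ 1`. The convention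
`S₀(·, x) = x` yields the first entry `z₁`, and `S₁(z₁, x) = R₁⁻¹(z₁, x)`. -/
def inverseRosenblatt (C : ℕ → ℝ → ℝ → ℝ) : (k : ℕ) → (Fin k → ℝ) → ℝ → ℝ
  | 0, _, x => x
  | k + 1, z, x =>
    forwardRosenblattInv C (k + 1)
      (fun i => inverseRosenblatt C i.val (fun j => z (Fin.castLE i.isLt.le j)) (z i)) x
termination_by k => k
decreasing_by exact i.isLt

/-- `σₖ`, the nonnegative root of `∏_{j=1}^k (1 - αⱼ²)`; in particular `σ₀ = 1`. -/
def sigma (α : ℕ → ℝ) (k : ℕ) : ℝ := √(∏ j ∈ Finset.Icc 1 k, (1 - α j ^ 2))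

/-- The coefficients `φⱼ⁽ᵏ⁾ = phi α k j`, for `1 ≤ j ≤ k` (and `0` outside of this range):
`φₖ⁽ᵏ⁾ = αₖ` and `φⱼ⁽ᵏ⁾ = φⱼ⁽ᵏ⁻¹⁾ - αₖ φₖ₋ⱼ⁽ᵏ⁻¹⁾` for `1 ≤ j ≤ k - 1`. -/
def phi (α : ℕ → ℝ) : ℕ → ℕ → ℝ
  | 0, _ => 0
  | k + 1, j =>
    if j = k + 1 then α (k + 1)
    else if 1 ≤ j ∧ j ≤ k then phi α k j - α (k + 1) * phi α k (k + 1 - j)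
    else 0

/-- The coefficients `ψⱼ⁽ᵏ⁾ = psi α k j`, for `0 ≤ j ≤ k`: `ψ₀⁽ᵏ⁾ = σₖ` (which is `1` for `k = 0`)
and `ψⱼ⁽ᵏ⁾ = ∑_{i=1}^j φᵢ⁽ᵏ⁾ ψⱼ₋ᵢ⁽ᵏ⁻ⁱ⁾` for `1 ≤ j ≤ k`; the index `i : Fin (j + 1)`
below stands for `i + 1`. -/
def psi (α : ℕ → ℝ) : ℕ → ℕ → ℝ
  | k, 0 => sigma α k
  | k, j + 1 => ∑ i : Fin (j + 1), phi α k (i.val + 1) * psi α (k - (i.val + 1)) (j - i.val)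
termination_by _ j => j
decreasing_by omega

end

end SVine

open Set Filter Topology MeasureTheory ProbabilityTheory

namespace SVine

/-! On the scale of normal scores every map is affine. Conditioning in the bivariate normal law
gives `h⁽¹⁾(Φ(a), Φ(b)) = Φ((b - r a) / √(1 - r²))`, and symmetrically for `h⁽²⁾`
(`hOne_gaussianCopula`, `hTwo_gaussianCopula`). By induction `Rₖ` and `R⁽²⁾ₖ` are `Φ` of the scaled
residuals of a forward and a backward linear predictor, with the same coefficients in reversed
order. Subtracting `αₖ₊₁` times one residual from the other is the Durbin–Levinson step, and the
scales multiply to `σₖ₊₁` (`rosenblattPair_gaussianCopula`). Inverting in `x` solves an affine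
equation. Inserting the earlier `Sᵢ` into this autoregression and collecting terms by lag yields the
recursion for `ψ` (`sum_phi_mul_sum_psi`). -/

/-- The fundamental theorem of calculus on a half-line. -/
theorem hasStrictDerivAt_integral_Iic {f : ℝ → ℝ} (hf : Continuous f) (hi : Integrable f) (a : ℝ) :
    HasStrictDerivAt (fun x => ∫ s in Iic x, f s) (f a) a := by
  have h : (fun x => ∫ s in Iic x, f s) =
      fun x => (∫ s in (0 : ℝ)..x, f s) + ∫ s in Iic (0 : ℝ), f s := by
    funext x
    rw [← intervalIntegral.integral_Iic_sub_Iic hi.integrableOn hi.integrableOn]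
    ring
  rw [h]
  exact (intervalIntegral.integral_hasStrictDerivAt_right (hf.intervalIntegrable _ _)
    (hf.stronglyMeasurableAtFilter _ _) hf.continuousAt).add_const _

/-! ### The standard normal distribution and quantile functions. -/

theorem continuous_gaussianPDFReal (m : ℝ) (v : NNReal) : Continuous (gaussianPDFReal m v) := by
  unfold gaussianPDFReal
  fun_prop

theorem stdNormalCDF_eq_integral (x : ℝ) :
    stdNormalCDF x = ∫ s in Iic x, gaussianPDFReal 0 1 s := by
  rw [stdNormalCDF, cdf_eq_real, Measure.real, gaussianReal_apply_eq_integral 0 one_ne_zero,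
    ENNReal.toReal_ofReal]
  exact integral_nonneg fun s => gaussianPDFReal_nonneg _ _ _

theorem hasStrictDerivAt_stdNormalCDF (x : ℝ) :
    HasStrictDerivAt stdNormalCDF (gaussianPDFReal 0 1 x) x := by
  rw [show stdNormalCDF = _ from funext stdNormalCDF_eq_integral]
  exact hasStrictDerivAt_integral_Iic (continuous_gaussianPDFReal 0 1)
    (integrable_gaussianPDFReal 0 1) x

theorem continuous_stdNormalCDF : Continuous stdNormalCDF :=
  continuous_iff_continuousAt.2 fun x => (hasStrictDerivAt_stdNormalCDF x).hasDerivAt.continuousAt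

theorem strictMono_stdNormalCDF : StrictMono stdNormalCDF :=
  strictMono_of_deriv_pos fun x => by
    rw [(hasStrictDerivAt_stdNormalCDF x).hasDerivAt.deriv]
    exact gaussianPDFReal_pos _ _ _ one_ne_zero

theorem tendsto_stdNormalCDF_atBot : Tendsto stdNormalCDF atBot (𝓝 0) := tendsto_cdf_atBot _

theorem tendsto_stdNormalCDF_atTop : Tendsto stdNormalCDF atTop (𝓝 1) := tendsto_cdf_atTop _

theorem stdNormalCDF_mem_Ioo (x : ℝ) : stdNormalCDF x ∈ Ioo (0 : ℝ) 1 := by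
  constructor
  · exact (cdf_nonneg _ _).trans_lt (strictMono_stdNormalCDF (sub_one_lt x))
  · exact (strictMono_stdNormalCDF (lt_add_one x)).trans_le (cdf_le_one _ _)

@[simp]
theorem stdNormalQuantile_stdNormalCDF (x : ℝ) : stdNormalQuantile (stdNormalCDF x) = x :=
  Function.leftInverse_invFun strictMono_stdNormalCDF.injective x

theorem exists_stdNormalCDF_eq {p : ℝ} (hp : p ∈ Ioo (0 : ℝ) 1) : ∃ x, stdNormalCDF x = p := by
  obtain ⟨a, ha⟩ := (tendsto_stdNormalCDF_atBot.eventually_lt_const hp.1).exists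
  obtain ⟨b, hb⟩ := (tendsto_stdNormalCDF_atTop.eventually_const_lt hp.2).exists
  exact mem_range_of_exists_le_of_exists_ge continuous_stdNormalCDF ⟨a, ha.le⟩ ⟨b, hb.le⟩

theorem stdNormalCDF_stdNormalQuantile {p : ℝ} (hp : p ∈ Ioo (0 : ℝ) 1) :
    stdNormalCDF (stdNormalQuantile p) = p :=
  Function.invFun_eq (exists_stdNormalCDF_eq hp)

/-- The inverse function theorem, which is where strict differentiability of `Φ` is needed. -/
theorem hasDerivAt_stdNormalQuantile (x : ℝ) :
    HasDerivAt stdNormalQuantile (gaussianPDFReal 0 1 x)⁻¹ (stdNormalCDF x) :=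
  ((hasStrictDerivAt_stdNormalCDF x).to_local_left_inverse
    (gaussianPDFReal_pos _ _ _ one_ne_zero).ne'
    (Eventually.of_forall stdNormalQuantile_stdNormalCDF)).hasDerivAt

/-! ### The bivariate normal law and the Gaussian h-functions. -/

theorem one_sub_sq_pos_of_abs_lt_one {r : ℝ} (hr : |r| < 1) : 0 < 1 - r ^ 2 :=
  sub_pos.2 ((sq_lt_one_iff_abs_lt_one r).2 hr)

/-- The bivariate density as a marginal density times a conditional density. -/
theorem bivariateNormalDensity_eq_mul {r : ℝ} (hr : |r| < 1) (s t : ℝ) :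
    bivariateNormalDensity r s t = gaussianPDFReal 0 1 s *
      (gaussianPDFReal 0 1 ((t - r * s) / √(1 - r ^ 2)) * (1 / √(1 - r ^ 2))) := by
  have h := one_sub_sq_pos_of_abs_lt_one hr
  have hs : 0 < √(1 - r ^ 2) := Real.sqrt_pos.2 h
  have hq : √(1 - r ^ 2) ^ 2 = 1 - r ^ 2 := Real.sq_sqrt h.le
  have hpi : √(2 * Real.pi) ^ 2 = 2 * Real.pi := Real.sq_sqrt (by positivity)
  have hpi0 : 0 < √(2 * Real.pi) := Real.sqrt_pos.2 (by positivity)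
  have he : -(s ^ 2 - 2 * r * s * t + t ^ 2) / (2 * (1 - r ^ 2)) =
      -s ^ 2 / 2 + -((t - r * s) / √(1 - r ^ 2)) ^ 2 / 2 := by
    rw [div_pow, hq]
    field_simp
    ring
  simp only [bivariateNormalDensity, gaussianPDFReal, NNReal.coe_one, mul_one, sub_zero]
  rw [he, Real.exp_add]
  field_simp
  rw [hpi]

theorem bivariateNormalDensity_comm (r s t : ℝ) :
    bivariateNormalDensity r s t = bivariateNormalDensity r t s := by
  unfold bivariateNormalDensity
  congr 3
  ring

theorem integrable_bivariateNormalDensity_right {r : ℝ} (hr : |r| < 1) (s : ℝ) :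
    Integrable (bivariateNormalDensity r s) := by
  have hs : √(1 - r ^ 2) ≠ 0 := (Real.sqrt_pos.2 (one_sub_sq_pos_of_abs_lt_one hr)).ne'
  rw [show bivariateNormalDensity r s = _ from funext (bivariateNormalDensity_eq_mul hr s)]
  exact ((((integrable_gaussianPDFReal 0 1).comp_div hs).comp_sub_right (r * s)).mul_const
    _).const_mul _

theorem integrable_bivariateNormalDensity {r : ℝ} (hr : |r| < 1) :
    Integrable (Function.uncurry (bivariateNormalDensity r)) (volume.prod volume) := by
  have h := one_sub_sq_pos_of_abs_lt_one hr
  -- Since `2rst ≤ |r|(s² + t²)`, the quadratic form is at least `(1 - |r|)(s² + t²)`, so a product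
  -- of Gaussians with rate `b` dominates.
  set b := (1 - |r|) / (2 * (1 - r ^ 2)) with hb
  have hb0 : 0 < b := div_pos (sub_pos.2 hr) (by positivity)
  refine (((integrable_exp_neg_mul_sq hb0).mul_prod (integrable_exp_neg_mul_sq hb0)).const_mul
    (1 / (2 * Real.pi * √(1 - r ^ 2)))).mono' ?_ ?_
  · refine Continuous.aestronglyMeasurable ?_
    unfold Function.uncurry bivariateNormalDensity
    fun_prop
  · refine Eventually.of_forall fun p => ?_
    obtain ⟨s, t⟩ := p
    have hst : 2 * r * s * t ≤ |r| * (s ^ 2 + t ^ 2) := by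
      have h1 : r * (s * t) ≤ |r| * |s * t| := by
        rw [← abs_mul]; exact le_abs_self _
      have h2 : 2 * |s * t| ≤ s ^ 2 + t ^ 2 := by
        rw [abs_mul]
        nlinarith [sq_nonneg (|s| - |t|), sq_abs s, sq_abs t]
      nlinarith [mul_le_mul_of_nonneg_left h2 (abs_nonneg r)]
    simp only [Function.uncurry, bivariateNormalDensity]
    rw [Real.norm_of_nonneg (by positivity), ← Real.exp_add]
    gcongr
    have : -b * s ^ 2 + -b * t ^ 2 = -((1 - |r|) * (s ^ 2 + t ^ 2)) / (2 * (1 - r ^ 2)) := by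
      rw [hb]; ring
    rw [this]
    gcongr
    linarith

theorem bivariateNormalCDF_comm {r : ℝ} (hr : |r| < 1) (a b : ℝ) :
    bivariateNormalCDF r a b = bivariateNormalCDF r b a := by
  unfold bivariateNormalCDF
  rw [integral_integral_swap]
  · simp only [bivariateNormalDensity_comm r]
  · rw [Measure.prod_restrict]
    exact (integrable_bivariateNormalDensity hr).integrableOn

theorem integral_Iic_bivariateNormalDensity {r : ℝ} (hr : |r| < 1) (s b : ℝ) :
    ∫ t in Iic b, bivariateNormalDensity r s t =
      gaussianPDFReal 0 1 s * stdNormalCDF ((b - r * s) / √(1 - r ^ 2)) := by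
  have hs : 0 < √(1 - r ^ 2) := Real.sqrt_pos.2 (one_sub_sq_pos_of_abs_lt_one hr)
  have hd : ∀ t ∈ Iic b, HasDerivAt
      (fun t => gaussianPDFReal 0 1 s * stdNormalCDF ((t - r * s) / √(1 - r ^ 2)))
      (bivariateNormalDensity r s t) t := by
    intro t _
    rw [bivariateNormalDensity_eq_mul hr]
    exact ((hasStrictDerivAt_stdNormalCDF _).hasDerivAt.comp t
      (((hasDerivAt_id t).sub_const _).div_const _)).const_mul _
  have hl : Tendsto (fun t => gaussianPDFReal 0 1 s * stdNormalCDF ((t - r * s) / √(1 - r ^ 2)))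
      atBot (𝓝 0) := by
    rw [show 𝓝 (0 : ℝ) = 𝓝 (gaussianPDFReal 0 1 s * 0) by rw [mul_zero]]
    refine (tendsto_stdNormalCDF_atBot.comp ?_).const_mul _
    exact (tendsto_atBot_add_const_right _ (-(r * s)) tendsto_id).atBot_div_const hs
  rw [integral_Iic_of_hasDerivAt_of_tendsto' hd
    (integrable_bivariateNormalDensity_right hr s).integrableOn hl, sub_zero]

theorem hasDerivAt_bivariateNormalCDF {r : ℝ} (hr : |r| < 1) (a b : ℝ) :
    HasDerivAt (fun a => bivariateNormalCDF r a b)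
      (gaussianPDFReal 0 1 a * stdNormalCDF ((b - r * a) / √(1 - r ^ 2))) a := by
  simp only [bivariateNormalCDF, integral_Iic_bivariateNormalDensity hr]
  refine (hasStrictDerivAt_integral_Iic
    (f := fun s => gaussianPDFReal 0 1 s * stdNormalCDF ((b - r * s) / √(1 - r ^ 2)))
    ?_ ?_ a).hasDerivAt
  · exact (continuous_gaussianPDFReal 0 1).mul (continuous_stdNormalCDF.comp (by fun_prop))
  · refine (integrable_gaussianPDFReal 0 1).mul_bdd (c := 1)
      (continuous_stdNormalCDF.comp (by fun_prop)).aestronglyMeasurable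
      (Eventually.of_forall fun s => ?_)
    rw [Real.norm_of_nonneg (stdNormalCDF_mem_Ioo _).1.le]
    exact (stdNormalCDF_mem_Ioo _).2.le

/-- By the chain rule, the derivative of the quantile cancels the marginal density and leaves the
conditional distribution function. -/
theorem hOne_gaussianCopula {r : ℝ} (hr : |r| < 1) (a b : ℝ) :
    hOne (gaussianCopula r) (stdNormalCDF a) (stdNormalCDF b) =
      stdNormalCDF ((b - r * a) / √(1 - r ^ 2)) := by
  have h := hasDerivAt_bivariateNormalCDF hr (stdNormalQuantile (stdNormalCDF a)) b
  have hd := h.comp (stdNormalCDF a) (hasDerivAt_stdNormalQuantile a)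
  simp only [hOne, gaussianCopula, stdNormalQuantile_stdNormalCDF] at hd ⊢
  refine hd.deriv.trans ?_
  have := (gaussianPDFReal_pos 0 1 a one_ne_zero).ne'
  field_simp

theorem hTwo_gaussianCopula {r : ℝ} (hr : |r| < 1) (a b : ℝ) :
    hTwo (gaussianCopula r) (stdNormalCDF a) (stdNormalCDF b) =
      stdNormalCDF ((a - r * b) / √(1 - r ^ 2)) := by
  rw [← hOne_gaussianCopula hr]
  simp only [hOne, hTwo, gaussianCopula,
    bivariateNormalCDF_comm hr (stdNormalQuantile (stdNormalCDF a))]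

/-! ### Durbin–Levinson coefficients and the forward functions. -/

theorem sigma_zero (α : ℕ → ℝ) : sigma α 0 = 1 := by simp [sigma]

theorem sigma_pos {α : ℕ → ℝ} (hα : ∀ k : ℕ, 1 ≤ k → |α k| < 1) (k : ℕ) : 0 < sigma α k :=
  Real.sqrt_pos.2 (Finset.prod_pos fun j hj =>
    one_sub_sq_pos_of_abs_lt_one (hα j (Finset.mem_Icc.1 hj).1))

theorem sigma_succ {α : ℕ → ℝ} (hα : ∀ k : ℕ, 1 ≤ k → |α k| < 1) (k : ℕ) :
    sigma α (k + 1) = sigma α k * √(1 - α (k + 1) ^ 2) := by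
  rw [sigma, Finset.prod_Icc_succ_top (by omega), Real.sqrt_mul, sigma]
  exact Finset.prod_nonneg fun j hj =>
    (one_sub_sq_pos_of_abs_lt_one (hα j (Finset.mem_Icc.1 hj).1)).le

theorem phi_succ_last (α : ℕ → ℝ) (k : ℕ) : phi α (k + 1) (k + 1) = α (k + 1) := by
  simp [phi]

theorem phi_succ_castSucc (α : ℕ → ℝ) {k : ℕ} (j : Fin k) :
    phi α (k + 1) (j + 1) = phi α k (j + 1) - α (k + 1) * phi α k (j.rev + 1) := by
  have hj := j.isLt
  rw [phi, if_neg (by omega), if_pos (by omega), Fin.val_rev]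
  congr 3
  omega

/-- The Rosenblatt functions of both kinds on the scale of normal scores. -/
theorem rosenblattPair_gaussianCopula {α : ℕ → ℝ} (hα : ∀ k : ℕ, 1 ≤ k → |α k| < 1) (k : ℕ)
    (a : Fin k → ℝ) (y : ℝ) :
    (rosenblattPair (fun m => gaussianCopula (α m)) k).1 (fun i => stdNormalCDF (a i))
        (stdNormalCDF y) =
      stdNormalCDF ((y - ∑ j : Fin k, phi α k (j + 1) * a j.rev) / sigma α k) ∧
    (rosenblattPair (fun m => gaussianCopula (α m)) k).2 (fun i => stdNormalCDF (a i))
        (stdNormalCDF y) =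
      stdNormalCDF ((y - ∑ j : Fin k, phi α k (j + 1) * a j) / sigma α k) := by
  -- Each half at level `k + 1` uses both halves at level `k`, one of them evaluated at an entry of
  -- `a` instead of `y`.
  induction k generalizing y with
  | zero => simp [rosenblattPair, sigma_zero]
  | succ k ih =>
    have hr := hα (k + 1) (by omega)
    have hs : sigma α k ≠ 0 := (sigma_pos hα k).ne'
    have hq : √(1 - α (k + 1) ^ 2) ≠ 0 :=
      (Real.sqrt_pos.2 (one_sub_sq_pos_of_abs_lt_one hr)).ne'
    simp only [rosenblattPair, Fin.tail_def, Fin.init_def]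
    constructor
    · rw [(ih (fun i => a i.succ) y).1, (ih (fun i => a i.succ) (a 0)).2,
        hOne_gaussianCopula hr, sigma_succ hα, Fin.sum_univ_castSucc]
      -- Reversing the index matches the reflected coefficients of the recursion with the backward
      -- predictor.
      have h := Equiv.sum_comp Fin.revPerm fun j : Fin k => phi α k (j + 1) * a j.succ
      simp only [Fin.revPerm_apply] at h
      simp only [Fin.val_castSucc, Fin.val_last, phi_succ_last, phi_succ_castSucc,
        Fin.rev_castSucc, Fin.rev_last, sub_mul, Finset.sum_sub_distrib, mul_assoc,
        ← Finset.mul_sum, h]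
      congr 1
      field_simp
      ring
    · rw [(ih (fun i => a i.castSucc) y).2, (ih (fun i => a i.castSucc) (a (Fin.last k))).1,
        hTwo_gaussianCopula hr, sigma_succ hα, Fin.sum_univ_castSucc]
      have h := Equiv.sum_comp Fin.revPerm fun j : Fin k =>
        phi α k (j.rev + 1) * a j.castSucc
      simp only [Fin.revPerm_apply, Fin.rev_rev] at h
      simp only [Fin.val_castSucc, Fin.val_last, phi_succ_last, phi_succ_castSucc,
        sub_mul, Finset.sum_sub_distrib, mul_assoc, ← Finset.mul_sum, h]
      congr 1
      field_simp
      ring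

theorem forwardRosenblatt_gaussianCopula {α : ℕ → ℝ} (hα : ∀ k : ℕ, 1 ≤ k → |α k| < 1) {k : ℕ}
    {u : Fin k → ℝ} (hu : ∀ i, u i ∈ Ioo (0 : ℝ) 1) {x : ℝ} (hx : x ∈ Ioo (0 : ℝ) 1) :
    forwardRosenblatt (fun m => gaussianCopula (α m)) k u x =
      stdNormalCDF ((stdNormalQuantile x -
        ∑ j : Fin k, phi α k (j + 1) * stdNormalQuantile (u j.rev)) / sigma α k) := by
  have h := (rosenblattPair_gaussianCopula hα k (fun i => stdNormalQuantile (u i))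
    (stdNormalQuantile x)).1
  simp only [stdNormalCDF_stdNormalQuantile (hu _), stdNormalCDF_stdNormalQuantile hx] at h
  exact h

/-! ### Inversion of the forward functions. -/

theorem bijOn_forwardRosenblatt_gaussianCopula {α : ℕ → ℝ} (hα : ∀ k : ℕ, 1 ≤ k → |α k| < 1)
    {k : ℕ} {u : Fin k → ℝ} (hu : ∀ i, u i ∈ Ioo (0 : ℝ) 1) :
    BijOn (forwardRosenblatt (fun m => gaussianCopula (α m)) k u) (Ioo 0 1) (Ioo 0 1) := by
  have hs : sigma α k ≠ 0 := (sigma_pos hα k).ne'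
  refine ⟨fun x hx => ?_, fun x hx y hy hxy => ?_, fun p hp => ?_⟩
  · rw [forwardRosenblatt_gaussianCopula hα hu hx]
    exact stdNormalCDF_mem_Ioo _
  · rw [forwardRosenblatt_gaussianCopula hα hu hx, forwardRosenblatt_gaussianCopula hα hu hy] at hxy
    have h := sub_left_injective ((div_left_inj' hs).1 (strictMono_stdNormalCDF.injective hxy))
    rw [← stdNormalCDF_stdNormalQuantile hx, h, stdNormalCDF_stdNormalQuantile hy]
  · refine ⟨stdNormalCDF (sigma α k * stdNormalQuantile p +
      ∑ j : Fin k, phi α k (j + 1) * stdNormalQuantile (u j.rev)), stdNormalCDF_mem_Ioo _, ?_⟩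
    rw [forwardRosenblatt_gaussianCopula hα hu (stdNormalCDF_mem_Ioo _),
      stdNormalQuantile_stdNormalCDF, add_sub_cancel_right, mul_div_cancel_left₀ _ hs,
      stdNormalCDF_stdNormalQuantile hp]

theorem forwardRosenblattInv_gaussianCopula {α : ℕ → ℝ} (hα : ∀ k : ℕ, 1 ≤ k → |α k| < 1)
    {k : ℕ} {u : Fin k → ℝ} (hu : ∀ i, u i ∈ Ioo (0 : ℝ) 1) {p : ℝ} (hp : p ∈ Ioo (0 : ℝ) 1) :
    forwardRosenblattInv (fun m => gaussianCopula (α m)) k u p =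
      stdNormalCDF (sigma α k * stdNormalQuantile p +
        ∑ j : Fin k, phi α k (j + 1) * stdNormalQuantile (u j.rev)) := by
  have hs : sigma α k ≠ 0 := (sigma_pos hα k).ne'
  have hb := bijOn_forwardRosenblatt_gaussianCopula hα hu
  have hm := hb.surjOn.mapsTo_invFunOn hp
  refine hb.injOn hm (stdNormalCDF_mem_Ioo _) ?_
  rw [hb.surjOn.rightInvOn_invFunOn hp,
    forwardRosenblatt_gaussianCopula hα hu (stdNormalCDF_mem_Ioo _),
    stdNormalQuantile_stdNormalCDF, add_sub_cancel_right, mul_div_cancel_left₀ _ hs,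
    stdNormalCDF_stdNormalQuantile hp]

/-! ### Moving-average form of the inverse functions. -/

theorem psi_zero (α : ℕ → ℝ) (k : ℕ) : psi α k 0 = sigma α k := by
  rw [psi]

theorem psi_succ (α : ℕ → ℝ) (k j : ℕ) :
    psi α k (j + 1) =
      ∑ i ∈ Finset.range (j + 1), phi α k (i + 1) * psi α (k - (i + 1)) (j - i) := by
  rw [psi, Finset.sum_range]

/-- Substituting the moving-average forms into the autoregression. -/
theorem sum_phi_mul_sum_psi (α ζ : ℕ → ℝ) (k : ℕ) :
    ∑ i ∈ Finset.range k, phi α k (i + 1) *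
        ∑ l ∈ Finset.range (k - i), psi α (k - (i + 1)) l * ζ (k - (i + 1) - l) =
      ∑ j ∈ Finset.range k, psi α k (j + 1) * ζ (k - (j + 1)) := by
  simp only [psi_succ, Finset.sum_mul, Finset.mul_sum]
  -- The double sum is regrouped along the diagonals `i + l = j`.
  rw [← Finset.sum_range_diag_flip k fun i l =>
    phi α k (i + 1) * (psi α (k - (i + 1)) l * ζ (k - (i + 1) - l))]
  refine Finset.sum_congr rfl fun j _ => Finset.sum_congr rfl fun i hi => ?_
  have hi' := Finset.mem_range.1 hi
  rw [show k - (i + 1) - (j - i) = k - (j + 1) by omega, mul_assoc]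

/-- Taking all arguments from one sequence `ζ` on `ℕ`, with `ζ k` the score of `x`, makes every
nested `Sᵢ` an instance of the same statement, so strong induction applies. -/
theorem inverseRosenblatt_gaussianCopula {α : ℕ → ℝ} (hα : ∀ k : ℕ, 1 ≤ k → |α k| < 1)
    (ζ : ℕ → ℝ) (k : ℕ) :
    inverseRosenblatt (fun m => gaussianCopula (α m)) k (fun i => stdNormalCDF (ζ i))
        (stdNormalCDF (ζ k)) =
      stdNormalCDF (∑ j ∈ Finset.range (k + 1), psi α k j * ζ (k - j)) := by
  induction k using Nat.strong_induction_on with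
  | _ k ih =>
    cases k with
    | zero => simp [inverseRosenblatt, psi_zero, sigma_zero]
    | succ k =>
      rw [inverseRosenblatt]
      simp only [Fin.val_castLE]
      have h : (fun i : Fin (k + 1) => inverseRosenblatt (fun m => gaussianCopula (α m)) i
          (fun j => stdNormalCDF (ζ j)) (stdNormalCDF (ζ i))) =
          fun i : Fin (k + 1) => stdNormalCDF
            (∑ j ∈ Finset.range (i + 1), psi α i j * ζ (i - j)) :=
        funext fun i => ih i i.isLt
      rw [h, forwardRosenblattInv_gaussianCopula hα (fun _ => stdNormalCDF_mem_Ioo _)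
        (stdNormalCDF_mem_Ioo _), Finset.sum_range_succ', ← sum_phi_mul_sum_psi,
        Finset.sum_range, psi_zero, add_comm]
      simp only [stdNormalQuantile_stdNormalCDF, Nat.sub_zero, Fin.val_rev]
      congr 2
      refine Finset.sum_congr rfl fun i _ => ?_
      have hi := i.isLt
      rw [show k + 1 - (i.val + 1) + 1 = k + 1 - i by omega]

end SVine

theorem mainTheorem2 (α : ℕ → ℝ) (hα : ∀ k : ℕ, 1 ≤ k → |α k| < 1) (k : ℕ) (hk : 1 ≤ k) :
    (∀ u : Fin k → ℝ, (∀ i, u i ∈ Set.Ioo (0 : ℝ) 1) →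
      Set.BijOn (SVine.forwardRosenblatt (fun m => SVine.gaussianCopula (α m)) k u)
        (Set.Ioo (0 : ℝ) 1) (Set.Ioo (0 : ℝ) 1) ∧
      ∀ x ∈ Set.Ioo (0 : ℝ) 1,
        SVine.forwardRosenblatt (fun m => SVine.gaussianCopula (α m)) k u x =
          SVine.stdNormalCDF
            ((SVine.stdNormalQuantile x -
                ∑ j : Fin k, SVine.phi α k (j.val + 1) * SVine.stdNormalQuantile (u j.rev)) /
              SVine.sigma α k)) ∧
    (∀ z : Fin k → ℝ, (∀ i, z i ∈ Set.Ioo (0 : ℝ) 1) → ∀ x ∈ Set.Ioo (0 : ℝ) 1,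
        SVine.inverseRosenblatt (fun m => SVine.gaussianCopula (α m)) k z x =
          SVine.stdNormalCDF
            (SVine.sigma α k * SVine.stdNormalQuantile x +
              ∑ j : Fin k, SVine.psi α k (j.val + 1) * SVine.stdNormalQuantile (z j.rev))) := by
  refine ⟨fun u hu => ⟨SVine.bijOn_forwardRosenblatt_gaussianCopula hα hu,
    fun x hx => SVine.forwardRosenblatt_gaussianCopula hα hu hx⟩, fun z hz x hx => ?_⟩
  -- The scores of `z` are followed by that of `x` at index `k`; later values play no role.
  let ζ : ℕ → ℝ := fun n =>
    if h : n < k then SVine.stdNormalQuantile (z ⟨n, h⟩) else SVine.stdNormalQuantile x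
  have hζ : ∀ i : Fin k, ζ i = SVine.stdNormalQuantile (z i) := fun i => dif_pos i.isLt
  have hζk : ζ k = SVine.stdNormalQuantile x := dif_neg (lt_irrefl k)
  have h := SVine.inverseRosenblatt_gaussianCopula hα ζ k
  simp only [hζ, hζk, SVine.stdNormalCDF_stdNormalQuantile (hz _),
    SVine.stdNormalCDF_stdNormalQuantile hx] at h
  rw [h, Finset.sum_range_succ', SVine.psi_zero, Nat.sub_zero, hζk, add_comm, Finset.sum_range]
  simp only [← hζ, Fin.val_rev]
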